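/- Let $L^\infty(0,1)$ be the real Banach space of (classes of) essentially bounded Lebesgue measurable functions on $(0,1)$ with the essential supremum norm. A rotation of a real Banach space $E$ is a linear isometry of $E$ onto $E$. For a group $\mathcal{G}$ of rotations of $E$, the space $E$ is called convex-transitive with respect to $\mathcal{G}$ if for every $x\in E$ with $\|x\|=1$ the closed convex hull of the orbit $\{T(x) : T\in\mathcal{G}\}$ equals the closed unit ball of $E$. For every separable real Banach space $X$ there is a separable closed linear subspace $Y\subseteq L^\infty(0,1)$ such that $X$ embeds linearly and isometrically into $Y$, and such that $Y$ is convex-transitive with respect to the group $$\mathcal{G}_*=\{T|_Y : T \text{ is a rotation of } L^\infty(0,1) \text{ with } T(Y)=Y\}.$$ -/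

import Mathlib

open MeasureTheory
open scoped ENNReal

/-- The real Banach space `L^∞(0,1)` for Lebesgue measure on the open unit interval. -/
abbrev LInftyUnit : Type := Lp ℝ ∞ ((volume : Measure ℝ).restrict (Set.Ioo 0 1))

/-- The group of rotations of `E`: its linear isometries onto itself, under composition. -/
abbrev Rotations (E : Type*) [NormedAddCommGroup E] [NormedSpace ℝ E] : Type _ :=
  E ≃ₗᵢ[ℝ] E

/-- The rotations of the subspace `Y` that are restrictions `T|_Y` of rotations `T` of `E` with
`T(Y) = Y`. -/
def restrictedRotations {E : Type*} [NormedAddCommGroup E] [NormedSpace ℝ E]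
    (Y : Submodule ℝ E) : Subgroup (Rotations Y) where
  carrier := {S | ∃ T : Rotations E, T '' (Y : Set E) = (Y : Set E) ∧
    ∀ y : Y, (S y : E) = T (y : E)}
  one_mem' := ⟨1, by simp, fun y => by simp⟩
  mul_mem' := by
    rintro S S' ⟨T, hT, hS⟩ ⟨T', hT', hS'⟩
    refine ⟨T * T', ?_, fun y => ?_⟩
    · rw [LinearIsometryEquiv.coe_mul, Set.image_comp, hT', hT]
    · simp [hS, hS']
  inv_mem' := by
    rintro S ⟨T, hT, hS⟩
    refine ⟨T⁻¹, ?_, fun y => ?_⟩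
    · conv_lhs => rw [← hT]
      rw [← Set.image_comp, ← LinearIsometryEquiv.coe_mul, inv_mul_cancel]
      simp
    · apply T.injective
      rw [← hS]
      simp [LinearIsometryEquiv.inv_def]

/-- `E` is convex-transitive with respect to the group `G` of rotations: for every `x` in the unit
sphere, the closed convex hull of the orbit of `x` under `G` is the closed unit ball. -/
def ConvexTransitiveWrt {E : Type*} [NormedAddCommGroup E] [NormedSpace ℝ E]
    (G : Subgroup (Rotations E)) : Prop :=
  ∀ x ∈ Metric.sphere (0 : E) 1,
    closure (convexHull ℝ {z : E | ∃ T ∈ G, z = T x}) = Metric.closedBall (0 : E) 1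

/-! The whole space $L^\infty(0,1)$ is convex-transitive, and this descends to separable subspaces.

For the whole space, convex combinations of the functions with values `±‖x‖` approximate the ball of
radius `‖x‖` (`mem_of_forall_sign_mem`). Off any one of countably many disjoint pieces of the
interval, such a function is within `δ` of a rotation of `x`: an automorphism of the measure class
moves everything else into a set where `|x| > ‖x‖ - δ`, and a unimodular weight corrects the sign.
Averaging over many exceptional pieces makes the error small (`sign_mem_closure_convexHull_orbit`).

For the descent, each pair of vectors needs only countably many rotations, so a countable set can be
closed under sums, rational multiples, and the rotations chosen for its pairs together with their
inverses; its closure is `Y` (`exists_separable_convexTransitiveWrt`). Starting from a dense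
sequence in an isometric copy of `X` puts `X` inside `Y`. -/

/-! ### Isomorphisms of atomless measures on the line -/

open Filter Topology Set ProbabilityTheory Measure in
/-- A probability measure on the line without atoms is isomorphic, modulo null sets, to Lebesgue
measure on the unit interval: the isomorphisms are the distribution function and the quantile
function. -/
lemma exists_measurePreserving_unitInterval (μ : Measure ℝ) [IsProbabilityMeasure μ]
    [NullSingletonClass μ] :
    ∃ F G : ℝ → ℝ, MeasurePreserving F μ (volume.restrict (Ioo (0 : ℝ) 1)) ∧
      MeasurePreserving G (volume.restrict (Ioo (0 : ℝ) 1)) μ ∧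
      (∀ᵐ t ∂μ, G (F t) = t) ∧ ∀ᵐ u ∂(volume.restrict (Ioo (0 : ℝ) 1)), F (G u) = u := by
  set lam : Measure ℝ := volume.restrict (Ioo (0 : ℝ) 1) with hlam
  have hprob : IsProbabilityMeasure lam := ⟨by simp [hlam]⟩
  let Q : ℝ → ℝ := fun u => sInf {t | u ≤ cdf μ t}
  have hFm : Measurable (cdf μ) := (monotone_cdf μ).measurable
  -- The quantile function and the distribution function form a Galois connection; right continuity
  -- is what makes the infimum attained.
  have hgal : ∀ u ∈ Ioo (0 : ℝ) 1, ∀ t, Q u ≤ t ↔ u ≤ cdf μ t := by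
    intro u hu t
    have hne : {t | u ≤ cdf μ t}.Nonempty :=
      (((tendsto_cdf_atTop μ).eventually (lt_mem_nhds hu.2)).exists).imp fun _ h => h.le
    have hbdd : BddBelow {t | u ≤ cdf μ t} := by
      obtain ⟨s, hs⟩ := ((tendsto_cdf_atBot μ).eventually (gt_mem_nhds hu.1)).exists
      refine ⟨s, fun r hr => le_of_not_gt fun hrs => ?_⟩
      exact absurd (hr.trans (monotone_cdf μ hrs.le)) (not_le.2 hs)
    refine ⟨fun h => ?_, fun h => csInf_le hbdd h⟩
    have hc : Tendsto (cdf μ) (𝓝[>] t) (𝓝 (cdf μ t)) :=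
      ((cdf μ).right_continuous t).mono_left (nhdsWithin_mono _ Ioi_subset_Ici_self)
    refine ge_of_tendsto hc ?_
    filter_upwards [self_mem_nhdsWithin] with s hs
    obtain ⟨r, hr, hrs⟩ := exists_lt_of_csInf_lt hne (h.trans_lt hs)
    exact le_trans hr (monotone_cdf μ hrs.le)
  have hinv : ∀ u ∈ Ioo (0 : ℝ) 1, cdf μ (Q u) = u := by
    intro u hu
    refine le_antisymm ?_ ((hgal u hu _).1 le_rfl)
    -- Without atoms the distribution function does not jump at `Q u`, and to the left of `Q u` its
    -- values are at most `u`.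
    have h1 := (cdf μ).measure_singleton (Q u)
    rw [measure_cdf, measure_singleton, eq_comm, ENNReal.ofReal_eq_zero, sub_nonpos] at h1
    refine h1.trans ?_
    refine le_of_tendsto ((monotone_cdf μ).tendsto_leftLim (Q u)) ?_
    filter_upwards [self_mem_nhdsWithin] with s hs
    exact le_of_not_ge fun h => absurd ((hgal u hu s).2 h) (not_le.2 hs)
  -- Outside the unit interval the defining set of `Q` may be empty or unbounded below, so `Q` is
  -- cut off there.
  let G : ℝ → ℝ := (Ioo (0 : ℝ) 1).indicator Q
  have hGQ : ∀ u ∈ Ioo (0 : ℝ) 1, G u = Q u := fun u hu => indicator_of_mem hu _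
  have hGm : Measurable G := by
    refine measurable_of_Iic fun t => ?_
    have : G ⁻¹' Iic t = (Ioo (0 : ℝ) 1 ∩ Iic (cdf μ t)) ∪ ((Ioo (0 : ℝ) 1)ᶜ ∩ {_u | 0 ≤ t}) := by
      ext u
      by_cases hu : u ∈ Ioo (0 : ℝ) 1
      · have := hgal u hu t
        simp only [mem_preimage, hGQ u hu, mem_Iic, mem_union, mem_inter_iff, hu, mem_compl_iff,
          true_and, not_true_eq_false, false_and, or_false, this]
      · have h0 : G u = 0 := indicator_of_notMem hu _
        simp only [mem_preimage, h0, mem_Iic, mem_union, mem_inter_iff, hu, mem_compl_iff,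
          false_and, not_false_eq_true, true_and, false_or, mem_ofPred_eq]
    rw [this]
    exact (measurableSet_Ioo.inter measurableSet_Iic).union
      (measurableSet_Ioo.compl.inter (MeasurableSet.const _))
  have hGmap : lam.map G = μ := by
    have : IsProbabilityMeasure (lam.map G) := isProbabilityMeasure_map hGm.aemeasurable
    refine ext_of_Iic _ _ fun t => ?_
    rw [map_apply hGm measurableSet_Iic, hlam, restrict_apply (hGm measurableSet_Iic),
      ← ofReal_cdf μ t]
    have hle := cdf_le_one μ t
    have h0 := cdf_nonneg μ t
    have : G ⁻¹' Iic t ∩ Ioo 0 1 = Ioo 0 1 ∩ Iic (cdf μ t) := by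
      ext u
      simp only [mem_inter_iff, mem_preimage, mem_Iic]
      rw [and_comm]
      refine and_congr_right fun hu => ?_
      rw [hGQ u hu, hgal u hu]
    rw [this]
    refine le_antisymm ((measure_mono (t := Ioc 0 (cdf μ t)) fun u hu => ⟨hu.1.1, hu.2⟩).trans_eq
      (by simp)) ?_
    refine le_trans (by simp) (measure_mono (s := Ioo 0 (cdf μ t)) fun u hu =>
      ⟨⟨hu.1, hu.2.trans_le hle⟩, hu.2.le⟩)
  have hFG : ∀ᵐ u ∂lam, cdf μ (G u) = u := by
    filter_upwards [ae_restrict_mem measurableSet_Ioo] with u hu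
    rw [hGQ u hu, hinv u hu]
  refine ⟨cdf μ, G, ⟨hFm, ?_⟩, ⟨hGm, hGmap⟩, ?_, hFG⟩
  · calc μ.map (cdf μ) = (lam.map G).map (cdf μ) := by rw [hGmap]
      _ = lam.map (cdf μ ∘ G) := map_map hFm hGm
      _ = lam := (map_congr (g := id) hFG).trans map_id
  · have : ∀ᵐ t ∂(lam.map G), G (cdf μ t) = t := by
      refine (ae_map_iff hGm.aemeasurable
        (measurableSet_eq_fun (hGm.comp hFm) measurable_id)).2 ?_
      filter_upwards [hFG] with u hu
      simp only [Function.comp_apply, id_eq, hu]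
    rwa [hGmap] at this

open Measure in
/-- Two nonzero finite measures on the line without atoms are isomorphic as measure classes. -/
lemma exists_quasiMeasurePreserving_inverse (μ ν : Measure ℝ) [IsFiniteMeasure μ] [NeZero μ]
    [NullSingletonClass μ] [IsFiniteMeasure ν] [NeZero ν] [NullSingletonClass ν] :
    ∃ f g : ℝ → ℝ, QuasiMeasurePreserving f μ ν ∧ QuasiMeasurePreserving g ν μ ∧
      (∀ᵐ t ∂μ, g (f t) = t) ∧ ∀ᵐ t ∂ν, f (g t) = t := by
  have key : ∀ (ρ : Measure ℝ) [IsFiniteMeasure ρ] [NeZero ρ] [NullSingletonClass ρ], ∃ F G : ℝ → ℝ,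
      QuasiMeasurePreserving F ρ (volume.restrict (Set.Ioo (0 : ℝ) 1)) ∧
      QuasiMeasurePreserving G (volume.restrict (Set.Ioo (0 : ℝ) 1)) ρ ∧
      (∀ᵐ t ∂ρ, G (F t) = t) ∧ ∀ᵐ u ∂(volume.restrict (Set.Ioo (0 : ℝ) 1)), F (G u) = u := by
    intro ρ _ _ _
    have hc : (ρ Set.univ)⁻¹ ≠ 0 := ENNReal.inv_ne_zero.2 (measure_ne_top _ _)
    have : NullSingletonClass ((ρ Set.univ)⁻¹ • ρ) := ⟨fun x => by simp⟩
    obtain ⟨F, G, hF, hG, hGF, hFG⟩ := exists_measurePreserving_unitInterval ((ρ Set.univ)⁻¹ • ρ)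
    refine ⟨F, G, hF.quasiMeasurePreserving.mono_left (Measure.absolutelyContinuous_smul hc),
      hG.quasiMeasurePreserving.mono_right smul_absolutelyContinuous, ?_, hFG⟩
    exact (absolutelyContinuous_smul hc).ae_le hGF
  obtain ⟨F, G, hF, hG, hGF, hFG⟩ := key μ
  obtain ⟨F', G', hF', hG', hGF', hFG'⟩ := key ν
  refine ⟨G' ∘ F, G ∘ F', hG'.comp hF, hG.comp hF', ?_, ?_⟩
  · filter_upwards [hGF, hF.ae hFG'] with t h1 h2
    simp only [Function.comp_apply, h2, h1]
  · filter_upwards [hGF', hF'.ae hFG] with t h1 h2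
    simp only [Function.comp_apply, h2, h1]

open Measure in
open scoped Classical in
/-- For an atomless finite measure on the line, some automorphism of the measure class carries `C`
into `B`, provided that neither `B`, `C` nor their complements are null. -/
lemma exists_quasiMeasurePreserving_mapsTo (μ : Measure ℝ) [IsFiniteMeasure μ] [NullSingletonClass μ]
    {B C : Set ℝ} (hB : MeasurableSet B) (hC : MeasurableSet C) (hB0 : μ B ≠ 0) (hB1 : μ Bᶜ ≠ 0)
    (hC0 : μ C ≠ 0) (hC1 : μ Cᶜ ≠ 0) :
    ∃ f g : ℝ → ℝ, QuasiMeasurePreserving f μ μ ∧ QuasiMeasurePreserving g μ μ ∧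
      (∀ᵐ t ∂μ, g (f t) = t) ∧ (∀ᵐ t ∂μ, f (g t) = t) ∧ ∀ᵐ t ∂μ, t ∈ C → f t ∈ B := by
  have nz : ∀ {s}, μ s ≠ 0 → NeZero (μ.restrict s) := fun h =>
    ⟨fun h' => h (restrict_eq_zero.1 h')⟩
  have := nz hB0
  have := nz hB1
  have := nz hC0
  have := nz hC1
  -- An isomorphism of `C` with `B` is glued to one of the complements; this is why all four sets
  -- must be non-null.
  obtain ⟨f₁, g₁, hf₁, hg₁, hgf₁, hfg₁⟩ :=
    exists_quasiMeasurePreserving_inverse (μ.restrict C) (μ.restrict B)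
  obtain ⟨f₂, g₂, hf₂, hg₂, hgf₂, hfg₂⟩ :=
    exists_quasiMeasurePreserving_inverse (μ.restrict Cᶜ) (μ.restrict Bᶜ)
  have split : ∀ {s : Set ℝ} (_ : MeasurableSet s) {p : ℝ → Prop},
      (∀ᵐ t ∂μ.restrict s, p t) → (∀ᵐ t ∂μ.restrict sᶜ, p t) → ∀ᵐ t ∂μ, p t := by
    intro s hs p h1 h2
    rw [ae_restrict_iff' hs] at h1
    rw [ae_restrict_iff' hs.compl] at h2
    filter_upwards [h1, h2] with t h1 h2
    by_cases ht : t ∈ s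
    exacts [h1 ht, h2 ht]
  have qmp : ∀ {s r : Set ℝ} (_ : MeasurableSet s) {u v : ℝ → ℝ},
      QuasiMeasurePreserving u (μ.restrict s) (μ.restrict r) →
      QuasiMeasurePreserving v (μ.restrict sᶜ) (μ.restrict rᶜ) →
      QuasiMeasurePreserving (s.piecewise u v) μ μ := by
    intro s r hs u v hu hv
    refine ⟨hu.measurable.piecewise hs hv.measurable, ?_⟩
    refine AbsolutelyContinuous.mk fun N hN hN0 => ?_
    rw [map_apply (hu.measurable.piecewise hs hv.measurable) hN]
    have hN' : ∀ᵐ t ∂μ, t ∉ N := measure_eq_zero_iff_ae_notMem.1 hN0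
    refine measure_eq_zero_iff_ae_notMem.2 (split hs ?_ ?_)
    · filter_upwards [hu.ae (ae_restrict_of_ae hN'), ae_restrict_mem hs] with t h1 h2
      simpa [Set.piecewise, h2] using h1
    · filter_upwards [hv.ae (ae_restrict_of_ae hN'), ae_restrict_mem hs.compl] with t h1 h2
      have : t ∉ s := h2
      simpa [Set.piecewise, this] using h1
  refine ⟨C.piecewise f₁ f₂, B.piecewise g₁ g₂, qmp hC hf₁ hf₂, qmp hB hg₁ hg₂, split hC ?_ ?_,
    split hB ?_ ?_, split hC ?_ ?_⟩
  · filter_upwards [ae_restrict_mem hC, hf₁.ae (ae_restrict_mem hB), hgf₁] with t h1 h2 h3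
    simp [Set.piecewise, h1, h2, h3]
  · filter_upwards [ae_restrict_mem hC.compl, hf₂.ae (ae_restrict_mem hB.compl), hgf₂]
      with t h1 h2 h3
    rw [Set.mem_compl_iff] at h1 h2
    simp [Set.piecewise, h1, h2, h3]
  · filter_upwards [ae_restrict_mem hB, hg₁.ae (ae_restrict_mem hC), hfg₁] with t h1 h2 h3
    simp [Set.piecewise, h1, h2, h3]
  · filter_upwards [ae_restrict_mem hB.compl, hg₂.ae (ae_restrict_mem hC.compl), hfg₂]
      with t h1 h2 h3
    rw [Set.mem_compl_iff] at h1 h2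
    simp [Set.piecewise, h1, h2, h3]
  · filter_upwards [ae_restrict_mem hC, hf₁.ae (ae_restrict_mem hB)] with t h1 h2
    simp [Set.piecewise, h1, h2]
  · filter_upwards [ae_restrict_mem hC.compl] with t h1 h2
    exact absurd h2 h1

/-! ### Weighted composition operators as rotations -/

section WeightedComposition

variable {α : Type*} [MeasurableSpace α] {μ : Measure α}

lemma ae_abs_le_norm (x : Lp ℝ ∞ μ) : ∀ᵐ t ∂μ, |x t| ≤ ‖x‖ := by
  filter_upwards [ae_le_eLpNormEssSup (f := x) (μ := μ)] with t ht
  rw [Lp.norm_def, eLpNorm_exponent_top, ← Real.norm_eq_abs, ← toReal_enorm]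
  refine ENNReal.toReal_mono ?_ ht
  rw [← eLpNorm_exponent_top]
  exact Lp.eLpNorm_ne_top x

lemma norm_le_of_ae_abs_le {x : Lp ℝ ∞ μ} {C : ℝ} (hC : 0 ≤ C) (h : ∀ᵐ t ∂μ, |x t| ≤ C) :
    ‖x‖ ≤ C := by
  rw [Lp.norm_def, eLpNorm_exponent_top]
  exact ENNReal.toReal_le_of_le_ofReal hC (eLpNormEssSup_le_of_ae_bound h)

lemma ae_abs_le_norm_comp (x : Lp ℝ ∞ μ) {θ : α → ℝ} (hθ : ∀ t, |θ t| = 1) {f : α → α}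
    (hf : Measure.QuasiMeasurePreserving f μ μ) : ∀ᵐ t ∂μ, |θ t * x (f t)| ≤ ‖x‖ := by
  filter_upwards [hf.ae (ae_abs_le_norm x)] with t ht
  rwa [abs_mul, hθ, one_mul]

lemma memLp_top_weight_mul_comp {θ : α → ℝ} (hθm : Measurable θ) (hθ : ∀ t, |θ t| = 1) {f : α → α}
    (hf : Measure.QuasiMeasurePreserving f μ μ) (x : Lp ℝ ∞ μ) :
    MemLp (fun t => θ t * x (f t)) ∞ μ :=
  memLp_top_of_bound (hθm.aestronglyMeasurable.mul
    ((Lp.aestronglyMeasurable x).comp_quasiMeasurePreserving hf)) ‖x‖ (ae_abs_le_norm_comp x hθ hf)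

/-- The weighted composition operator `x ↦ θ · (x ∘ f)` on `L^∞`, for a unimodular weight. -/
noncomputable def weightedComp (θ : α → ℝ) (hθm : Measurable θ) (hθ : ∀ t, |θ t| = 1) (f : α → α)
    (hf : Measure.QuasiMeasurePreserving f μ μ) : Lp ℝ ∞ μ →ₗ[ℝ] Lp ℝ ∞ μ where
  toFun x := (memLp_top_weight_mul_comp hθm hθ hf x).toLp
  map_add' x y := by
    rw [← MemLp.toLp_add, MemLp.toLp_eq_toLp_iff]
    filter_upwards [hf.ae (Lp.coeFn_add x y)] with t ht
    rw [ht]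
    exact mul_add _ _ _
  map_smul' c x := by
    rw [RingHom.id_apply, ← MemLp.toLp_const_smul, MemLp.toLp_eq_toLp_iff]
    filter_upwards [hf.ae (Lp.coeFn_smul c x)] with t ht
    rw [ht]
    exact mul_left_comm _ _ _

lemma coeFn_weightedComp (θ : α → ℝ) (hθm : Measurable θ) (hθ : ∀ t, |θ t| = 1) (f : α → α)
    (hf : Measure.QuasiMeasurePreserving f μ μ) (x : Lp ℝ ∞ μ) :
    weightedComp θ hθm hθ f hf x =ᵐ[μ] fun t => θ t * x (f t) :=
  (memLp_top_weight_mul_comp hθm hθ hf x).coeFn_toLp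

lemma norm_weightedComp_le (θ : α → ℝ) (hθm : Measurable θ) (hθ : ∀ t, |θ t| = 1) (f : α → α)
    (hf : Measure.QuasiMeasurePreserving f μ μ) (x : Lp ℝ ∞ μ) :
    ‖weightedComp θ hθm hθ f hf x‖ ≤ ‖x‖ := by
  refine norm_le_of_ae_abs_le (norm_nonneg x) ?_
  filter_upwards [coeFn_weightedComp θ hθm hθ f hf x, ae_abs_le_norm_comp x hθ hf] with t h1 h2
  rwa [h1]

/-- The inverse is `y ↦ (θ ∘ g) · (y ∘ g)`, because `θ² = 1`; mutually inverse contractions are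
isometries. -/
lemma exists_rotation_weightedComp (θ : α → ℝ) (hθm : Measurable θ) (hθ : ∀ t, |θ t| = 1)
    {f g : α → α} (hf : Measure.QuasiMeasurePreserving f μ μ)
    (hg : Measure.QuasiMeasurePreserving g μ μ) (hgf : ∀ᵐ t ∂μ, g (f t) = t)
    (hfg : ∀ᵐ t ∂μ, f (g t) = t) :
    ∃ T : Rotations (Lp ℝ ∞ μ), ∀ x, T x =ᵐ[μ] fun t => θ t * x (f t) := by
  have hsq : ∀ t, θ t * θ t = 1 := fun t => by rw [← abs_mul_abs_self, hθ, one_mul]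
  let W := weightedComp θ hθm hθ f hf
  let V := weightedComp (θ ∘ g) (hθm.comp hg.measurable) (fun t => hθ (g t)) g hg
  have hVW : ∀ x, V (W x) = x := fun x => by
    refine Lp.ext ?_
    filter_upwards [coeFn_weightedComp (θ ∘ g) (hθm.comp hg.measurable) (fun t => hθ (g t)) g hg
      (W x), hg.ae (coeFn_weightedComp θ hθm hθ f hf x), hfg] with t h1 h2 h3
    rw [h1, h2, h3, ← mul_assoc, Function.comp_apply, hsq, one_mul]
  have hWV : ∀ x, W (V x) = x := fun x => by
    refine Lp.ext ?_
    filter_upwards [coeFn_weightedComp θ hθm hθ f hf (V x), hf.ae (coeFn_weightedComp (θ ∘ g)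
      (hθm.comp hg.measurable) (fun t => hθ (g t)) g hg x), hgf] with t h1 h2 h3
    rw [h1, h2, Function.comp_apply, h3, ← mul_assoc, hsq, one_mul]
  refine ⟨⟨LinearEquiv.ofLinearMap W V (LinearMap.ext hWV) (LinearMap.ext hVW), fun x => ?_⟩,
    fun x => coeFn_weightedComp θ hθm hθ f hf x⟩
  refine le_antisymm (norm_weightedComp_le θ hθm hθ f hf x) ?_
  conv_lhs => rw [← hVW x]
  exact norm_weightedComp_le _ _ _ _ _ _

end WeightedComposition

/-! ### Convex-transitivity of the whole space -/

/-- The unit interval splits into countably many non-null measurable pieces. -/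
lemma exists_measurable_nat_fibers :
    ∃ k : ℝ → ℕ, Measurable k ∧
      ∀ i, (volume : Measure ℝ).restrict (Set.Ioo 0 1) (k ⁻¹' {i}) ≠ 0 := by
  -- On the unit interval `⌊t⁻¹⌋₊` starts at 1; the shift makes the fibre over 0 non-null too.
  refine ⟨fun t => ⌊t⁻¹⌋₊ - 1,
    (measurable_from_top (f := fun n : ℕ => n - 1)).comp (Nat.measurable_floor.comp measurable_inv),
    fun i => ?_⟩
  have hi : (0 : ℝ) < i + 1 := by positivity
  have hsub : Set.Ioo ((i + 2 : ℝ)⁻¹) ((i + 1 : ℝ)⁻¹) ⊆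
      ((fun t : ℝ => ⌊t⁻¹⌋₊ - 1) ⁻¹' {i}) ∩ Set.Ioo 0 1 := by
    intro t ht
    have ht0 : 0 < t := (by positivity : (0 : ℝ) < (i + 2 : ℝ)⁻¹).trans ht.1
    have h1 : (i + 1 : ℝ) < t⁻¹ := (lt_inv_comm₀ hi ht0).2 ht.2
    have h2 : t⁻¹ < i + 2 := (inv_lt_comm₀ ht0 (by positivity)).2 ht.1
    refine ⟨?_, ht0, ht.2.trans_le (inv_le_one_of_one_le₀ (by linarith [i.cast_nonneg (α := ℝ)]))⟩
    have : ⌊t⁻¹⌋₊ = i + 1 := by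
      rw [Nat.floor_eq_iff (by positivity)]
      push_cast
      exact ⟨h1.le, by linarith⟩
    simp [this]
  intro h0
  have h1 := measure_mono_null hsub
    (le_antisymm (h0 ▸ Measure.le_restrict_apply _ _) zero_le)
  rw [Real.volume_Ioo, ENNReal.ofReal_eq_zero, sub_nonpos] at h1
  exact absurd h1 (not_le.2 (inv_strictAnti₀ hi (by linarith)))

section Signs

variable {α : Type*} [MeasurableSpace α] {μ : Measure α}

lemma memLp_top_const_mul_sign (M : ℝ) {σ : α → ℝ} (hσm : Measurable σ) (hσ : ∀ t, |σ t| = 1) :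
    MemLp (fun t => M * σ t) ∞ μ :=
  memLp_top_of_bound (hσm.const_mul M).aestronglyMeasurable |M|
    (Filter.Eventually.of_forall fun t => by simp [hσ])

lemma measurable_ite_nonneg : Measurable fun s : ℝ => if 0 ≤ s then (1 : ℝ) else -1 :=
  Measurable.ite measurableSet_Ici measurable_const measurable_const

lemma abs_ite_nonneg (s : ℝ) : |if 0 ≤ s then (1 : ℝ) else -1| = 1 := by
  split_ifs <;> simp

/-- A closed convex set containing the functions with values `±M` contains the ball of radius
`M` of `L^∞`. -/
lemma mem_of_forall_sign_mem {M : ℝ} (hM : 0 ≤ M) {K : Set (Lp ℝ ∞ μ)} (hK : Convex ℝ K)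
    (hKc : IsClosed K)
    (hsign : ∀ (σ : α → ℝ) (hσm : Measurable σ) (hσ : ∀ t, |σ t| = 1),
      (memLp_top_const_mul_sign M hσm hσ).toLp ∈ K)
    {y : Lp ℝ ∞ μ} (hy : ‖y‖ ≤ M) : y ∈ K := by
  -- Binary expansion: with `s = M · sign y`, one has `y = (s + (2y - s)) / 2`, and `2y - s` stays
  -- in the ball of radius `M`. Each repetition halves the error.
  have key : ∀ (n : ℕ) (y : Lp ℝ ∞ μ), ‖y‖ ≤ M → ∃ k ∈ K, ‖y - k‖ ≤ 2 * M * (1 / 2) ^ n := by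
    intro n
    induction n with
    | zero =>
      intro y hy
      have h1 := hsign (fun _ => 1) measurable_const (fun _ => abs_one)
      refine ⟨_, h1, ?_⟩
      have h2 : ‖(memLp_top_const_mul_sign (μ := μ) M (σ := fun _ => 1) measurable_const
          (fun _ => abs_one)).toLp‖ ≤ M := by
        refine norm_le_of_ae_abs_le hM ?_
        filter_upwards [MemLp.coeFn_toLp (memLp_top_const_mul_sign (μ := μ) M (σ := fun _ => 1)
          measurable_const (fun _ => abs_one))] with t ht
        rw [ht, mul_one, abs_of_nonneg hM]
      refine (norm_sub_le _ _).trans ?_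
      linarith
    | succ n ih =>
      intro y hy
      let σ : α → ℝ := fun t => if 0 ≤ y t then 1 else -1
      have hσm : Measurable σ := measurable_ite_nonneg.comp (Lp.stronglyMeasurable y).measurable
      have hσ : ∀ t, |σ t| = 1 := fun t => abs_ite_nonneg _
      set s := (memLp_top_const_mul_sign (μ := μ) M hσm hσ).toLp with hs
      have hsK : s ∈ K := hsign σ hσm hσ
      have hy' : ‖(2 : ℝ) • y - s‖ ≤ M := by
        refine norm_le_of_ae_abs_le hM ?_
        filter_upwards [(memLp_top_const_mul_sign (μ := μ) M hσm hσ).coeFn_toLp,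
          Lp.coeFn_sub ((2 : ℝ) • y) s, Lp.coeFn_smul (2 : ℝ) y, ae_abs_le_norm y] with t h1 h2 h3 h4
        rw [h2, Pi.sub_apply, h3, Pi.smul_apply, hs, h1, smul_eq_mul]
        have h5 := abs_le.1 (h4.trans hy)
        simp only [σ]
        split_ifs with h <;> rw [abs_le] <;> constructor <;> linarith
      obtain ⟨k, hk, hyk⟩ := ih _ hy'
      refine ⟨(1 / 2 : ℝ) • s + (1 / 2 : ℝ) • k,
        hK hsK hk (by norm_num) (by norm_num) (by norm_num), ?_⟩
      have : y - ((1 / 2 : ℝ) • s + (1 / 2 : ℝ) • k) = (1 / 2 : ℝ) • ((2 : ℝ) • y - s - k) := by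
        module
      rw [this, norm_smul, Real.norm_of_nonneg (by norm_num), pow_succ]
      linarith
  refine hKc.closure_subset (Metric.mem_closure_iff.2 fun ε hε => ?_)
  have hlim : Filter.Tendsto (fun n : ℕ => 2 * M * (1 / 2 : ℝ) ^ n) Filter.atTop (nhds 0) := by
    simpa using (tendsto_pow_atTop_nhds_zero_of_lt_one (r := (1 / 2 : ℝ)) (by norm_num)
      (by norm_num)).const_mul (2 * M)
  obtain ⟨n, hn⟩ := (hlim.eventually (gt_mem_nhds hε)).exists
  obtain ⟨k, hk, hyk⟩ := key n y hy
  exact ⟨k, hk, by rw [dist_eq_norm]; exact hyk.trans_lt hn⟩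

end Signs

lemma sum_coeFn_ae {α ι : Type*} [MeasurableSpace α] {μ : Measure α} {p : ℝ≥0∞} (s : Finset ι)
    (v : ι → Lp ℝ p μ) : ⇑(∑ i ∈ s, v i) =ᵐ[μ] fun t => ∑ i ∈ s, v i t := by
  classical
  induction s using Finset.induction_on with
  | empty =>
    simp only [Finset.sum_empty]
    exact Lp.coeFn_zero _ _ _
  | insert a s ha ih =>
    simp only [Finset.sum_insert ha]
    filter_upwards [Lp.coeFn_add (v a) (∑ i ∈ s, v i), ih] with t h1 h2
    rw [h1, Pi.add_apply, h2]

/-- The functions with values `±‖x‖` are limits of averages of rotations of `x` in `L^∞(0,1)`. -/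
lemma sign_mem_closure_convexHull_orbit (x : LInftyUnit) {σ : ℝ → ℝ} (hσm : Measurable σ)
    (hσ : ∀ t, |σ t| = 1) :
    (memLp_top_const_mul_sign ‖x‖ hσm hσ).toLp ∈
      closure (convexHull ℝ (Set.range fun T : Rotations LInftyUnit => T x)) := by
  set lam : Measure ℝ := volume.restrict (Set.Ioo 0 1) with hlam
  rcases (norm_nonneg x).eq_or_lt with hx0 | hx0
  · refine subset_closure (subset_convexHull ℝ _ ⟨1, ?_⟩)
    have : x = 0 := norm_eq_zero.1 hx0.symm
    subst this
    refine Lp.ext ?_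
    filter_upwards [(memLp_top_const_mul_sign (μ := lam) ‖(0 : LInftyUnit)‖ hσm hσ).coeFn_toLp,
      Lp.coeFn_zero ℝ ∞ lam] with t h1 h2
    rw [h1, ← hx0, zero_mul]
    simpa using h2
  set M := ‖x‖ with hM
  set s := (memLp_top_const_mul_sign (μ := lam) M hσm hσ).toLp with hs
  obtain ⟨k, hkm, hk⟩ := exists_measurable_nat_fibers
  have hkm' : ∀ i, MeasurableSet (k ⁻¹' {i}) := fun i => hkm (measurableSet_singleton i)
  refine Metric.mem_closure_iff.2 fun ε hε => ?_
  set δ := ε / 3 with hδ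
  have hδ0 : 0 < δ := by positivity
  have hxm : Measurable x := (Lp.stronglyMeasurable x).measurable
  let B : Set ℝ := {t | M - δ < |x t|}
  have hBm : MeasurableSet B := measurableSet_lt measurable_const hxm.abs
  have hB : lam B ≠ 0 := by
    intro h0
    have h1 : ‖x‖ ≤ max (M - δ) 0 := by
      refine norm_le_of_ae_abs_le (le_max_right _ _) ?_
      filter_upwards [measure_eq_zero_iff_ae_notMem.1 h0] with t ht
      exact (not_lt.1 ht).trans (le_max_left _ _)
    exact absurd h1 (not_le.2 (max_lt (by linarith) hx0))
  -- `B` may have full measure; cutting it down to one fibre of `k` leaves a non-null complement.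
  obtain ⟨j, hj⟩ : ∃ j, lam (B ∩ k ⁻¹' {j}) ≠ 0 := by
    by_contra! h
    refine hB (measure_mono_null (fun t ht => ?_) (measure_iUnion_null h))
    exact Set.mem_iUnion.2 ⟨k t, ht, rfl⟩
  have hcompl : ∀ i, lam (k ⁻¹' {i})ᶜ ≠ 0 := fun i h => hk (i + 1) <| by
    refine measure_mono_null (fun t ht => ?_) h
    simp only [Set.mem_preimage, Set.mem_singleton_iff, Set.mem_compl_iff] at ht ⊢
    omega
  -- The complement of fibre `i` is carried into `B`, where `|x|` is within `δ` of `M`; on fibre `i`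
  -- itself the error is at most `M`.
  have hf : ∀ i, ∃ T : Rotations LInftyUnit, ∀ᵐ t ∂lam,
      |s t - T x t| ≤ δ + if k t = i then M else 0 := by
    intro i
    obtain ⟨f, g, hf, hg, hgf, hfg, hfB⟩ := exists_quasiMeasurePreserving_mapsTo lam
      (hBm.inter (hkm' j)) (hkm' i).compl hj
      (fun h => hcompl j (measure_mono_null (Set.compl_subset_compl.2 Set.inter_subset_right) h)) (hcompl i)
      (by rw [compl_compl]; exact hk i)
    obtain ⟨T, hT⟩ := exists_rotation_weightedComp
      (fun t => σ t * if 0 ≤ x (f t) then (1 : ℝ) else -1)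
      (hσm.mul (measurable_ite_nonneg.comp (hxm.comp hf.measurable)))
      (fun t => by rw [abs_mul, hσ, abs_ite_nonneg, one_mul]) hf hg hgf hfg
    refine ⟨T, ?_⟩
    filter_upwards [hT x, (memLp_top_const_mul_sign (μ := lam) M hσm hσ).coeFn_toLp, hfB,
      hf.ae (ae_abs_le_norm x)] with t h1 h2 h3 h4
    have h5 : σ t * (if 0 ≤ x (f t) then (1 : ℝ) else -1) * x (f t) = σ t * |x (f t)| := by
      split_ifs with h
      · rw [abs_of_nonneg h, mul_one]
      · rw [abs_of_neg (not_le.1 h)]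
        ring
    rw [h1, hs, h2, h5, mul_comm M, ← mul_sub, abs_mul, hσ, one_mul,
      abs_of_nonneg (sub_nonneg.2 h4)]
    split_ifs with h
    · linarith [abs_nonneg (x (f t))]
    · have h6 : M - δ < |x (f t)| := (h3 h).1
      linarith
  choose T hT using hf
  obtain ⟨n, hn⟩ := exists_nat_gt (M / δ)
  have hn0 : (0 : ℝ) < n := (by positivity : 0 < M / δ).trans hn
  refine ⟨∑ i ∈ Finset.range n, (n : ℝ)⁻¹ • T i x, ?_, ?_⟩
  · refine (convex_convexHull ℝ _).sum_mem (fun _ _ => by positivity) ?_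
      fun i _ => subset_convexHull ℝ _ ⟨T i, rfl⟩
    simp [hn0.ne']
  have hdiff : s - ∑ i ∈ Finset.range n, (n : ℝ)⁻¹ • T i x =
      (n : ℝ)⁻¹ • ∑ i ∈ Finset.range n, (s - T i x) := by
    rw [← Finset.smul_sum, Finset.sum_sub_distrib, smul_sub, Finset.sum_const, Finset.card_range,
      ← Nat.cast_smul_eq_nsmul ℝ, smul_smul, inv_mul_cancel₀ hn0.ne', one_smul]
  -- The fibres are disjoint, so at almost every point at most one summand contributes the large
  -- error `M`.
  have hsum : ‖∑ i ∈ Finset.range n, (s - T i x)‖ ≤ n * δ + M := by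
    refine norm_le_of_ae_abs_le (by positivity) ?_
    have hsub : ∀ᵐ t ∂lam, ∀ i, (s - T i x) t = s t - T i x t :=
      ae_all_iff.2 fun i => Lp.coeFn_sub s (T i x)
    filter_upwards [sum_coeFn_ae (Finset.range n) fun i => s - T i x, hsub, ae_all_iff.2 hT]
      with t h1 h2 h3
    rw [h1]
    refine (Finset.abs_sum_le_sum_abs _ _).trans ?_
    refine (Finset.sum_le_sum fun i _ => (h2 i ▸ h3 i : |(s - T i x) t| ≤ _)).trans ?_
    rw [Finset.sum_add_distrib, Finset.sum_const, Finset.card_range, nsmul_eq_mul,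
      Finset.sum_ite_eq]
    gcongr
    split_ifs
    exacts [le_rfl, hx0.le]
  rw [dist_eq_norm, hdiff, norm_smul, Real.norm_of_nonneg (by positivity)]
  calc (n : ℝ)⁻¹ * _ ≤ (n : ℝ)⁻¹ * (n * δ + M) := by gcongr
    _ = δ + M / n := by field_simp
    _ ≤ δ + δ := by
      gcongr
      rw [div_le_iff₀ hn0]
      rw [div_lt_iff₀ hδ0] at hn
      linarith
    _ < ε := by linarith

/-- The space `L^∞(0,1)` is convex-transitive. -/
theorem mem_closure_convexHull_orbit {x y : LInftyUnit} (h : ‖y‖ ≤ ‖x‖) :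
    y ∈ closure (convexHull ℝ (Set.range fun T : Rotations LInftyUnit => T x)) :=
  mem_of_forall_sign_mem (norm_nonneg x) (convex_convexHull ℝ _).closure isClosed_closure
    (fun _ hσm hσ => sign_mem_closure_convexHull_orbit x hσm hσ) h

/-! ### Isometric embedding of separable spaces -/

/-- A separable Banach space embeds isometrically into `L^∞(0,1)`, by means of a norming sequence
of functionals. -/
lemma exists_linearIsometry_LInftyUnit (X : Type*) [NormedAddCommGroup X] [NormedSpace ℝ X]
    [TopologicalSpace.SeparableSpace X] : Nonempty (X →ₗᵢ[ℝ] LInftyUnit) := by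
  set lam : Measure ℝ := volume.restrict (Set.Ioo 0 1) with hlam
  obtain ⟨k, hkm, hk⟩ := exists_measurable_nat_fibers
  choose φ hφ1 hφ2 using fun n : ℕ => exists_dual_vector'' ℝ (TopologicalSpace.denseSeq X n)
  have hle : ∀ x t, ‖φ (k t) x‖ ≤ ‖x‖ := fun x t => by
    simpa using (φ (k t)).le_of_opNorm_le (hφ1 (k t)) x
  have hmem : ∀ x, MemLp (fun t => φ (k t) x) ∞ lam := fun x =>
    memLp_top_of_bound ((measurable_from_nat (f := fun n => φ n x)).comp hkm).aestronglyMeasurable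
      ‖x‖ (Filter.Eventually.of_forall (hle x))
  refine ⟨⟨{ toFun := fun x => (hmem x).toLp, map_add' := fun x y => ?_,
             map_smul' := fun c x => ?_ }, fun x => ?_⟩⟩
  · rw [← MemLp.toLp_add, MemLp.toLp_eq_toLp_iff]
    exact Filter.Eventually.of_forall fun t => map_add _ _ _
  · rw [RingHom.id_apply, ← MemLp.toLp_const_smul, MemLp.toLp_eq_toLp_iff]
    exact Filter.Eventually.of_forall fun t => map_smul _ _ _
  change ‖(hmem x).toLp‖ = ‖x‖
  refine le_antisymm (norm_le_of_ae_abs_le (norm_nonneg x) ?_) (le_of_forall_pos_le_add ?_)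
  · filter_upwards [(hmem x).coeFn_toLp] with t ht
    rw [ht]
    exact hle x t
  · intro ε hε
    obtain ⟨n, hn⟩ := (TopologicalSpace.denseRange_denseSeq X).exists_dist_lt x (half_pos hε)
    set d := TopologicalSpace.denseSeq X n
    rw [dist_eq_norm] at hn
    have h1 : ‖x‖ ≤ |φ n x| + ε := by
      have h2 : ‖x‖ ≤ ‖d‖ + ‖x - d‖ := by simpa using norm_add_le d (x - d)
      have h3 : ‖φ n (d - x)‖ ≤ ‖d - x‖ := by
        simpa using (φ n).le_of_opNorm_le (hφ1 n) (d - x)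
      have h4 : φ n d = ‖d‖ := hφ2 n
      rw [map_sub, h4, norm_sub_rev d x, Real.norm_eq_abs] at h3
      linarith [le_abs_self (‖d‖ - φ n x), le_abs_self (φ n x)]
    have h5 : |φ n x| ≤ ‖(hmem x).toLp‖ := by
      by_contra h
      -- The function is constant on the non-null fibre over `n`, so an almost everywhere bound must
      -- hold for its value there.
      refine hk n (measure_mono_null (t := {t | ¬ |φ (k t) x| ≤ ‖(hmem x).toLp‖}) ?_ ?_)
      · intro t ht
        rw [Set.mem_preimage, Set.mem_singleton_iff] at ht
        rwa [Set.mem_ofPred_eq, ht]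
      · refine ae_iff.1 ?_
        filter_upwards [(hmem x).coeFn_toLp, ae_abs_le_norm (hmem x).toLp] with t h1 h2
        rwa [h1] at h2
    linarith

/-! ### Descent to a separable subspace -/

/-- A countable set generates a countable set under a ternary operation with countably many
values. -/
lemma exists_countable_closed {E : Type*} (R : E → E → E → Set E) (hR : ∀ a b c, (R a b c).Countable)
    {D : Set E} (hD : D.Countable) :
    ∃ A : Set E, A.Countable ∧ D ⊆ A ∧ ∀ a ∈ A, ∀ b ∈ A, ∀ c ∈ A, R a b c ⊆ A := by
  let S : ℕ → Set E := fun n =>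
    n.rec D fun _ s => s ∪ ⋃ a ∈ s, ⋃ b ∈ s, ⋃ c ∈ s, R a b c
  have hS : ∀ n, S (n + 1) = S n ∪ ⋃ a ∈ S n, ⋃ b ∈ S n, ⋃ c ∈ S n, R a b c := fun _ => rfl
  have hmono : Monotone S := monotone_nat_of_le_succ fun n => by
    rw [hS]
    exact Set.subset_union_left
  refine ⟨⋃ n, S n, Set.countable_iUnion fun n => ?_, Set.subset_iUnion S 0, ?_⟩
  · induction n with
    | zero => exact hD
    | succ n ih =>
      rw [hS]
      exact ih.union (ih.biUnion fun a _ => ih.biUnion fun b _ => ih.biUnion fun c _ => hR a b c)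
  · intro a ha b hb c hc z hz
    obtain ⟨i, hi⟩ := Set.mem_iUnion.1 ha
    obtain ⟨j, hj⟩ := Set.mem_iUnion.1 hb
    obtain ⟨l, hl⟩ := Set.mem_iUnion.1 hc
    have hi' := hmono ((le_max_left i j).trans (le_max_left _ l)) hi
    have hj' := hmono ((le_max_right i j).trans (le_max_left _ l)) hj
    have hl' := hmono (le_max_right (max i j) l) hl
    refine Set.mem_iUnion.2 ⟨max (max i j) l + 1, ?_⟩
    rw [hS]
    refine Or.inr ?_
    simp only [Set.mem_iUnion]
    exact ⟨a, hi', b, hj', c, hl', hz⟩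

/-- A point of the closed convex hull of the range of a map lies in the closed convex hull of a
countable part of it. -/
lemma exists_countable_mem_closure_convexHull {E ι : Type*} [NormedAddCommGroup E]
    [NormedSpace ℝ E] {f : ι → E} {y : E} (hy : y ∈ closure (convexHull ℝ (Set.range f))) :
    ∃ C : Set ι, C.Countable ∧ y ∈ closure (convexHull ℝ (f '' C)) := by
  obtain ⟨u, hu, huy⟩ := mem_closure_iff_seq_limit.1 hy
  have : ∀ n, ∃ t : Finset E, (t : Set E) ⊆ Set.range f ∧ u n ∈ convexHull ℝ (t : Set E) := by
    intro n
    have := hu n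
    rw [convexHull_eq_union_convexHull_finite_subsets] at this
    simpa only [Set.mem_iUnion, exists_prop] using this
  choose t ht hut using this
  -- One preimage is kept per point, so `C` inherits countability from its image.
  obtain ⟨C, -, hC⟩ := Set.SurjOn.exists_bijOn_subset
    (s := Set.univ) (t := ⋃ n, (t n : Set E)) (f := f)
    (by rw [Set.SurjOn, Set.image_univ]; exact Set.iUnion_subset ht)
  refine ⟨C, ?_, mem_closure_of_tendsto huy (Filter.Eventually.of_forall fun n => ?_)⟩
  · exact Set.countable_of_injective_of_countable_image hC.injOn
      (hC.image_eq ▸ Set.countable_iUnion fun n => (t n).countable_toSet)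
  · rw [hC.image_eq]
    exact convexHull_mono (Set.subset_iUnion (fun n => (t n : Set E)) n) (hut n)

section Restriction

variable {E : Type*} [NormedAddCommGroup E] [NormedSpace ℝ E]

lemma exists_mem_restrictedRotations {Y : Submodule ℝ E} (T : Rotations E)
    (hT : T '' (Y : Set E) = Y) :
    ∃ S ∈ restrictedRotations Y, ∀ y : Y, (S y : E) = T y := by
  let L : Y ≃ₗ[ℝ] Y := T.toLinearEquiv.ofSubmodules Y Y (SetLike.coe_injective hT)
  have hL : ∀ y : Y, (L y : E) = T y := fun y => rfl
  exact ⟨⟨L, fun y => by rw [Submodule.coe_norm, hL, T.norm_map, Submodule.coe_norm]⟩,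
    ⟨T, hT, hL⟩, hL⟩

open scoped Pointwise in
/-- In a convex-transitive space, every countable set lies in a separable closed subspace which is
convex-transitive with respect to the restrictions of rotations of the whole space. -/
theorem exists_separable_convexTransitiveWrt
    (hE : ∀ x y : E, ‖y‖ ≤ ‖x‖ → y ∈ closure (convexHull ℝ (Set.range fun T : Rotations E => T x)))
    {D : Set E} (hD : D.Countable) :
    ∃ Y : Submodule ℝ E, IsClosed (Y : Set E) ∧ TopologicalSpace.SeparableSpace Y ∧
      D ⊆ Y ∧ ConvexTransitiveWrt (restrictedRotations Y) := by
  have hC : ∀ x y : E, ∃ C : Set (Rotations E), C.Countable ∧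
      (‖y‖ ≤ ‖x‖ → y ∈ closure (convexHull ℝ ((fun T : Rotations E => T x) '' C))) := by
    intro x y
    by_cases h : ‖y‖ ≤ ‖x‖
    · obtain ⟨C, h1, h2⟩ := exists_countable_mem_closure_convexHull (hE x y h)
      exact ⟨C, h1, fun _ => h2⟩
    · exact ⟨∅, Set.countable_empty, fun h' => absurd h' h⟩
  choose C hCc hC using hC
  -- The third argument lets the rotations chosen for `(a, b)` act on all of `A`. With their
  -- inverses included they map `A` onto itself, hence `Y` onto `Y`.
  obtain ⟨A, hAc, hDA, hA⟩ := exists_countable_closed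
    (fun a b c => ({a + b} ∪ Set.range fun q : ℚ => (q : ℝ) • a) ∪
      ((fun T : Rotations E => T c) '' C a b ∪ (fun T : Rotations E => T.symm c) '' C a b))
    (fun a b c => ((Set.countable_singleton _).union (Set.countable_range _)).union
      (((hCc a b).image _).union ((hCc a b).image _)))
    (hD.union (Set.countable_singleton 0))
  have hA0 : (0 : E) ∈ A := hDA (Or.inr rfl)
  have hAadd : ∀ a ∈ A, ∀ b ∈ A, a + b ∈ A := fun a ha b hb =>
    hA a ha b hb a ha (Or.inl (Or.inl rfl))
  have hAsmul : ∀ (q : ℚ), ∀ a ∈ A, (q : ℝ) • a ∈ A := fun q a ha =>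
    hA a ha a ha a ha (Or.inl (Or.inr ⟨q, rfl⟩))
  let Y : Submodule ℝ E :=
    { carrier := closure A
      zero_mem' := subset_closure hA0
      add_mem' := fun ha hb => map_mem_closure₂ continuous_add ha hb hAadd
      smul_mem' := fun r a ha => by
        have hr : r ∈ closure (Set.range ((↑) : ℚ → ℝ)) := Rat.denseRange_cast r
        refine map_mem_closure₂ continuous_smul hr ha ?_
        rintro _ ⟨q, rfl⟩ a ha
        exact hAsmul q a ha }
  have hYA : (Y : Set E) = closure A := rfl
  have hTY : ∀ a ∈ A, ∀ b ∈ A, ∀ T ∈ C a b, T '' (Y : Set E) = Y := by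
    intro a ha b hb T hT
    have : T '' A = A := by
      refine Set.Subset.antisymm ?_ fun c hc => ?_
      · rintro _ ⟨c, hc, rfl⟩
        exact hA a ha b hb c hc (Or.inr (Or.inl ⟨T, hT, rfl⟩))
      · exact ⟨T.symm c, hA a ha b hb c hc (Or.inr (Or.inr ⟨T, hT, rfl⟩)), T.apply_symm_apply c⟩
    rw [hYA, ← LinearIsometryEquiv.coe_toHomeomorph, Homeomorph.image_closure,
      LinearIsometryEquiv.coe_toHomeomorph, this]
  refine ⟨Y, isClosed_closure, ?_, fun d hd => subset_closure (hDA (Or.inl hd)), ?_⟩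
  · exact (hAc.isSeparable.closure).separableSpace
  intro x hx
  rw [mem_sphere_zero_iff_norm] at hx
  refine Set.Subset.antisymm ?_ fun y hy => ?_
  · refine closure_minimal (convexHull_min ?_ (convex_closedBall 0 1)) Metric.isClosed_closedBall
    rintro _ ⟨T, -, rfl⟩
    rw [mem_closedBall_zero_iff, T.norm_map, hx]
  rw [mem_closedBall_zero_iff] at hy
  refine Metric.mem_closure_iff.2 fun ε hε => ?_
  -- The final error is below `2δ + δ + 2δ`: replacing `y` by `b`, approximating `b` by `u`, and
  -- replacing `a` by `x` in the orbit.
  set δ := min (ε / 6) 1 with hδ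
  have hδ0 : 0 < δ := by positivity
  have hδ1 : δ ≤ 1 := min_le_right _ _
  have hδε : δ ≤ ε / 6 := min_le_left _ _
  have approx : ∀ (z : Y) (r : ℝ), |r - 1| ≤ δ → ‖z‖ ≤ 1 →
      ∃ a ∈ A, ‖a - r • (z : E)‖ < δ ∧ ‖a - z‖ < 2 * δ := by
    intro z r hr hz
    obtain ⟨a, ha, haz⟩ := Metric.mem_closure_iff.1 (Y.smul_mem r z.2) δ hδ0
    rw [dist_comm, dist_eq_norm] at haz
    refine ⟨a, ha, haz, ?_⟩
    have h1 : a - z = (a - r • (z : E)) + (r - 1) • (z : E) := by module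
    have h2 : ‖(r - 1) • (z : E)‖ ≤ δ := by
      rw [norm_smul, Real.norm_eq_abs]
      exact (mul_le_of_le_one_right (abs_nonneg _) hz).trans hr
    rw [h1]
    exact (norm_add_le _ _).trans_lt (by linarith)
  -- Stretching `x` and shrinking `y` leaves a gap of `2δ` between the norms, which absorbs both
  -- approximation errors and gives `‖b‖ ≤ ‖a‖`.
  obtain ⟨a, ha, ha1, ha2⟩ := approx x (1 + δ) (by simp [abs_of_pos hδ0]) hx.le
  obtain ⟨b, hb, hb1, hb2⟩ := approx y (1 - δ) (by simp [abs_of_pos hδ0]) hy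
  have hba : ‖b‖ ≤ ‖a‖ := by
    have h1 : ‖(1 + δ) • (x : E)‖ = 1 + δ := by
      rw [norm_smul, Real.norm_of_nonneg (by linarith), ← Submodule.coe_norm, hx, mul_one]
    have h2 : ‖(1 - δ) • (y : E)‖ ≤ 1 - δ := by
      rw [norm_smul, Real.norm_of_nonneg (by linarith)]
      exact mul_le_of_le_one_right (by linarith) hy
    linarith [norm_sub_norm_le ((1 + δ) • (x : E)) a, norm_sub_rev a ((1 + δ) • (x : E)),
      norm_sub_norm_le b ((1 - δ) • (y : E))]
  obtain ⟨u, hu, hbu⟩ := Metric.mem_closure_iff.1 (hC a b hba) δ hδ0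
  rw [dist_eq_norm] at hbu
  set O : Set Y := {z | ∃ T ∈ restrictedRotations Y, z = T x}
  have hsub : convexHull ℝ ((fun T : Rotations E => T a) '' C a b) ⊆
      Y.subtype '' convexHull ℝ O + Metric.closedBall 0 (2 * δ) := by
    refine convexHull_min ?_
      (((convex_convexHull ℝ O).linear_image Y.subtype).add (convex_closedBall 0 _))
    rintro _ ⟨T, hT, rfl⟩
    obtain ⟨S, hS, hST⟩ := exists_mem_restrictedRotations T (hTY a ha b hb T hT)
    refine Set.mem_add.2 ⟨S x, ⟨S x, subset_convexHull ℝ _ ⟨S, hS, rfl⟩, rfl⟩, T a - S x, ?_,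
      add_sub_cancel _ _⟩
    rw [mem_closedBall_zero_iff, hST, ← map_sub, T.norm_map]
    exact ha2.le
  obtain ⟨_, ⟨v, hv, rfl⟩, w, hw, rfl⟩ := Set.mem_add.1 (hsub hu)
  rw [mem_closedBall_zero_iff] at hw
  refine ⟨v, hv, ?_⟩
  rw [dist_eq_norm, Submodule.coe_norm, Submodule.coe_sub]
  have : (y : E) - v = -(b - y) + (b - (Y.subtype v + w)) + w := by
    simp only [Submodule.subtype_apply]
    abel
  rw [this]
  refine (norm_add₃_le).trans_lt ?_
  rw [norm_neg]
  linarith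

end Restriction

theorem corollary2p7 (X : Type*) [NormedAddCommGroup X] [NormedSpace ℝ X] [CompleteSpace X]
    [TopologicalSpace.SeparableSpace X] :
    ∃ Y : Submodule ℝ LInftyUnit,
      IsClosed (Y : Set LInftyUnit) ∧
      TopologicalSpace.SeparableSpace Y ∧
      Nonempty (X →ₗᵢ[ℝ] Y) ∧
      ConvexTransitiveWrt (restrictedRotations Y) := by
  obtain ⟨J⟩ := exists_linearIsometry_LInftyUnit X
  obtain ⟨Y, hYc, hYs, hDY, hY⟩ := exists_separable_convexTransitiveWrt
    (fun x y h => mem_closure_convexHull_orbit h)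
    (Set.countable_range (J ∘ TopologicalSpace.denseSeq X))
  refine ⟨Y, hYc, hYs, ?_, hY⟩
  have hJ : ∀ x, J x ∈ Y := fun x =>
    closure_minimal (s := Set.range (TopologicalSpace.denseSeq X)) (t := J ⁻¹' Y)
      (Set.range_subset_iff.2 fun n => hDY ⟨n, rfl⟩) (hYc.preimage J.continuous)
      (TopologicalSpace.denseRange_denseSeq X x)
  exact ⟨⟨J.toLinearMap.codRestrict Y hJ, fun x => J.norm_map x⟩⟩
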